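/- For $n\ge 1$ let $PG_n$ denote the pancake graph: its vertices are the $n!$ permutations $a_1a_2\ldots a_n$ of $\{1,2,\ldots,n\}$, and two vertices $a_1\ldots a_n$ and $b_1\ldots b_n$ are adjacent if there is an integer $k$ with $2\le k\le n$ such that $a_i=b_{k+1-i}$ for $1\le i\le k$ and $a_i=b_i$ for $k+1\le i\le n$. A fractional perfect matching of a finite simple graph $G$ is a function $f:E(G)\to[0,1]$ such that $\sum_{e\ni v}f(e)=1$ for every vertex $v$ of $G$, the sum being over the edges $e$ of $G$ incident with $v$. Let $\mathrm{fmp}(G)$ be the minimum size of a set $F\subseteq E(G)$ such that $G-F$ has no fractional perfect matching, and let $\mathrm{fsmp}(G)$ be the minimum size of a set $F\subseteq V(G)\cup E(G)$ such that $G-F$ has no fractional perfect matching. **Theorem.** For every integer $n\ge 4$, $\mathrm{fsmp}(PG_n)=\mathrm{fmp}(PG_n)=n-1$. -/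

import Mathlib

/-- The pancake graph of dimension `n`. A vertex is a permutation `a`, read as the word
`a 0, a 1, …, a (n - 1)` (positions and symbols are numbered from `0`). Two words are adjacent
when one arises from the other by reversing a prefix of some length `k` with `2 ≤ k ≤ n`:
position `i < k` of one word carries the symbol at position `k - 1 - i` of the other. -/
def pancakeGraph (n : ℕ) : SimpleGraph (Equiv.Perm (Fin n)) where
  Adj a b := ∃ k : ℕ, 2 ≤ k ∧ k ≤ n ∧
    (∀ i j : Fin n, (i : ℕ) + (j : ℕ) + 1 = k → a i = b j) ∧
    (∀ i : Fin n, k ≤ (i : ℕ) → a i = b i)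
  symm := ⟨fun a b ⟨k, h2, hn, hrev, hfix⟩ =>
    ⟨k, h2, hn, fun i j hij => (hrev j i (by omega)).symm, fun i hi => (hfix i hi).symm⟩⟩
  loopless := ⟨fun a ⟨k, h2, hn, hrev, _⟩ => by
    have h := a.injective (hrev ⟨0, by omega⟩ ⟨k - 1, by omega⟩ (by simp; omega))
    have h' := congrArg Fin.val h
    simp at h'
    omega⟩

namespace SimpleGraph

open Classical in
/-- `f` is a fractional perfect matching of `G`: it assigns to each edge a number in `[0, 1]` such
that the values on the edges incident with any vertex sum to `1`. (Values of `f` on pairs that are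
not edges of `G` play no role.) -/
def IsFractionalPerfectMatching {V : Type*} [Fintype V] (G : SimpleGraph V)
    (f : Sym2 V → ℝ) : Prop :=
  (∀ e ∈ G.edgeSet, 0 ≤ f e ∧ f e ≤ 1) ∧ ∀ v : V, ∑ e ∈ G.incidenceFinset v, f e = 1

/-- `G` has a fractional perfect matching. -/
def HasFractionalPerfectMatching {V : Type*} [Fintype V] (G : SimpleGraph V) : Prop :=
  ∃ f : Sym2 V → ℝ, G.IsFractionalPerfectMatching f

/-- An FMP set: a set `F` of edges of `G` such that `G - F` has no fractional perfect matching. -/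
def IsFMPSet {V : Type*} [Fintype V] (G : SimpleGraph V) (F : Finset (Sym2 V)) : Prop :=
  (F : Set (Sym2 V)) ⊆ G.edgeSet ∧
    ¬ (G.deleteEdges (F : Set (Sym2 V))).HasFractionalPerfectMatching

open Classical in
/-- An FSMP set, given by its set `FV` of vertices and its set `FE` of edges of `G`: deleting the
edges in `FE` and the vertices in `FV` leaves a graph with no fractional perfect matching. -/
def IsFSMPSet {V : Type*} [Fintype V] (G : SimpleGraph V)
    (FV : Finset V) (FE : Finset (Sym2 V)) : Prop :=
  (FE : Set (Sym2 V)) ⊆ G.edgeSet ∧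
    ¬ ((G.deleteEdges (FE : Set (Sym2 V))).induce {v : V | v ∉ FV}).HasFractionalPerfectMatching

/-- The FMP number: the minimum size of an FMP set. -/
noncomputable def fmp {V : Type*} [Fintype V] (G : SimpleGraph V) : ℕ :=
  sInf {m : ℕ | ∃ F : Finset (Sym2 V), G.IsFMPSet F ∧ F.card = m}

/-- The FSMP number: the minimum size (vertices plus edges) of an FSMP set. -/
noncomputable def fsmp {V : Type*} [Fintype V] (G : SimpleGraph V) : ℕ :=
  sInf {m : ℕ | ∃ (FV : Finset V) (FE : Finset (Sym2 V)),
    G.IsFSMPSet FV FE ∧ FV.card + FE.card = m}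

end SimpleGraph

/-!
Fractional perfect matchings of subgraphs are points of the convex cone generated by the edges, so
they can be added, scaled and transported along embeddings.

Deleting the `n - 1` edges at a vertex isolates it. Conversely, for each `2 ≤ k ≤ n` the reversals
of the first `k` symbols form a perfect matching, and fewer than `n - 1` faulty edges leave one of
these matchings untouched.

With faulty vertices the proof goes by induction on `n`, the words ending in a given symbol forming
a copy of `PG_n` in `PG_(n + 1)`. If no copy carries `n - 1` faults, the copies are matched
separately. Otherwise all faults lie in one copy. Restore a faulty vertex `u` of it, match the copy,
and then reroute: a vertex `w` matched with `u` is matched instead with its neighbour outside the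
copy, and the other copies, less that neighbour, are matched separately. In `PG_4` a cycle of length
`23` avoids any given vertex. It covers the case of one faulty vertex, with a chord to bypass a
faulty edge; a second faulty vertex leaves a path with `22` vertices.
-/

open Finset SimpleGraph
open scoped NNReal

namespace FractionalMatching

variable {V W : Type*} [DecidableEq V] [DecidableEq W] {G : SimpleGraph V} {H : SimpleGraph W}
  {d g : V → ℝ}

/-- The cone of all vertex demands `d : V → ℝ` that nonnegative weights on the edges of `G` meet
exactly, the demand at a vertex being the total weight of the edges incident with it. -/
def edgeCone (G : SimpleGraph V) : Submodule ℝ≥0 (V → ℝ) :=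
  Submodule.span ℝ≥0 {d | ∃ u v, G.Adj u v ∧ Pi.single u 1 + Pi.single v 1 = d}

theorem single_add_single_mem_edgeCone {u v : V} (h : G.Adj u v) :
    Pi.single u 1 + Pi.single v 1 ∈ edgeCone G :=
  Submodule.subset_span ⟨u, v, h, rfl⟩

@[elab_as_elim]
theorem edgeCone_induction {p : (d : V → ℝ) → d ∈ edgeCone G → Prop}
    (edge : ∀ u v (huv : G.Adj u v),
      p (Pi.single u 1 + Pi.single v 1) (single_add_single_mem_edgeCone huv))
    (zero : p 0 (zero_mem _))
    (add : ∀ x y hx hy, p x hx → p y hy → p (x + y) (add_mem hx hy))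
    (smul : ∀ (c : ℝ≥0) x hx, p x hx → p (c • x) (Submodule.smul_mem _ c hx))
    (hd : d ∈ edgeCone G) : p d hd := by
  refine Submodule.span_induction ?_ zero add smul hd
  rintro _ ⟨u, v, huv, rfl⟩
  exact edge u v huv

theorem nonneg_of_mem_edgeCone (hd : d ∈ edgeCone G) : 0 ≤ d := by
  induction hd using edgeCone_induction with
  | edge u v _ => exact add_nonneg (Pi.single_nonneg.2 zero_le_one) (Pi.single_nonneg.2 zero_le_one)
  | zero => exact le_rfl
  | add x y _ _ hx hy => exact add_nonneg hx hy
  | smul c x _ hx => exact smul_nonneg c.2 hx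

theorem extend_mem_edgeCone {φ : V → W} (hφ : φ.Injective)
    (hadj : ∀ u v, G.Adj u v → H.Adj (φ u) (φ v)) (hd : d ∈ edgeCone G) :
    Function.extend φ d 0 ∈ edgeCone H := by
  have extend_single (u : V) :
      Function.extend φ (Pi.single u 1 : V → ℝ) 0 = Pi.single (φ u) 1 := by
    ext w
    by_cases hw : ∃ v, φ v = w
    · obtain ⟨v, rfl⟩ := hw
      simp [hφ.extend_apply, Pi.single_apply, hφ.eq_iff]
    · rw [Function.extend_apply' _ _ _ hw, Pi.single_eq_of_ne fun h => hw ⟨u, h.symm⟩,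
        Pi.zero_apply]
  have map_add (x y : V → ℝ) :
      Function.extend φ (x + y) 0 = Function.extend φ x 0 + Function.extend φ y 0 := by
    simpa using Function.extend_add φ x y (0 : W → ℝ) 0
  induction hd using edgeCone_induction with
  | edge u v huv =>
    rw [map_add, extend_single, extend_single]
    exact single_add_single_mem_edgeCone (hadj u v huv)
  | zero => rw [Function.extend_zero]; exact zero_mem _
  | add x y _ _ hx hy => rw [map_add]; exact add_mem hx hy
  | smul c x _ hx =>
    have := Function.extend_smul c φ x (0 : W → ℝ)
    rw [smul_zero] at this
    rw [this]
    exact Submodule.smul_mem _ c hx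

theorem indicator_image_mem_edgeCone {φ : V → W} (hφ : φ.Injective)
    (hadj : ∀ u v, G.Adj u v → H.Adj (φ u) (φ v)) {S : Set V}
    (hS : S.indicator 1 ∈ edgeCone G) : (φ '' S).indicator 1 ∈ edgeCone H := by
  classical
  convert extend_mem_edgeCone hφ hadj hS using 1
  ext w
  by_cases hw : ∃ v, φ v = w
  · obtain ⟨v, rfl⟩ := hw
    simp [hφ.extend_apply, Set.indicator_apply, hφ.eq_iff]
  · rw [Function.extend_apply' _ _ _ hw, Pi.zero_apply, Set.indicator_of_notMem]
    exact fun ⟨v, _, h⟩ => hw ⟨v, h⟩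

theorem comp_val_mem_edgeCone_induce {S : Set V} (hd : d ∈ edgeCone G) (hS : ∀ v ∉ S, d v = 0) :
    (fun v : S => d v) ∈ edgeCone (G.induce S) := by
  induction hd using edgeCone_induction with
  | edge u v huv =>
    have mem_of_ne_zero (w : V) (hw : (Pi.single u 1 + Pi.single v 1 : V → ℝ) w ≠ 0) : w ∈ S :=
      by_contra fun h => hw (hS w h)
    have hu : u ∈ S := mem_of_ne_zero u (by simp [huv.ne])
    have hv : v ∈ S := mem_of_ne_zero v (by simp [huv.ne'])
    convert single_add_single_mem_edgeCone (show (G.induce S).Adj ⟨u, hu⟩ ⟨v, hv⟩ from huv) using 1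
    ext w
    simp [Pi.single_apply, Subtype.ext_iff]
  | zero => exact zero_mem _
  | add x y hxG hyG hx hy =>
    have hzero : ∀ v ∉ S, x v = 0 ∧ y v = 0 := fun v hv =>
      (add_eq_zero_iff_of_nonneg (nonneg_of_mem_edgeCone hxG v)
        (nonneg_of_mem_edgeCone hyG v)).1 (hS v hv)
    exact add_mem (hx fun v hv => (hzero v hv).1) (hy fun v hv => (hzero v hv).2)
  | smul c x _ hx =>
    rcases eq_or_ne c 0 with rfl | hc
    · simp only [zero_smul, Pi.zero_apply]
      exact zero_mem _
    · exact Submodule.smul_mem _ c (hx fun v hv => (smul_eq_zero.1 (hS v hv)).resolve_left hc)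

section Paths

theorem sum_range_single_mem_edgeCone_of_matching {k : ℕ} {p : ℕ → V}
    (hp : ∀ i < k, G.Adj (p (2 * i)) (p (2 * i + 1))) :
    ∑ i ∈ range (2 * k), Pi.single (p i) 1 ∈ edgeCone G := by
  induction k with
  | zero => simp
  | succ k ih =>
    rw [mul_add_one, sum_range_succ, sum_range_succ, add_assoc]
    exact add_mem (ih fun i hi => hp i (by omega))
      (single_add_single_mem_edgeCone (hp k k.lt_succ_self))

theorem sum_range_single_mem_edgeCone_of_cycle {k : ℕ} {p : ℕ → V}
    (hp : ∀ i < k, G.Adj (p i) (p (i + 1))) (hclose : G.Adj (p k) (p 0)) :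
    ∑ i ∈ range (k + 1), Pi.single (p i) 1 ∈ edgeCone G := by
  have hsum := Submodule.smul_mem _ (2⁻¹ : ℝ≥0) <| add_mem
    (sum_mem fun i hi => single_add_single_mem_edgeCone (hp i (mem_range.1 hi)))
    (single_add_single_mem_edgeCone hclose)
  convert hsum using 1
  rw [sum_add_distrib, add_add_add_comm, ← sum_range_succ,
    ← sum_range_succ' fun i => Pi.single (p i) 1, ← two_smul ℝ≥0, inv_smul_smul₀ two_ne_zero]

/-- The chord closes a cycle, and the two ends of the path that it leaves over are matched. -/
theorem sum_range_single_mem_edgeCone_of_chord {a b k : ℕ} {p : ℕ → V}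
    (hp : ∀ i < 2 * a + k + 2 * b, G.Adj (p i) (p (i + 1)))
    (hchord : G.Adj (p (2 * a + k)) (p (2 * a))) :
    ∑ i ∈ range (2 * a + k + 2 * b + 1), Pi.single (p i) 1 ∈ edgeCone G := by
  rw [show 2 * a + k + 2 * b + 1 = 2 * a + (k + 1) + 2 * b by ring, sum_range_add, sum_range_add]
  refine add_mem (add_mem ?_ ?_) ?_
  · exact sum_range_single_mem_edgeCone_of_matching fun i hi => hp _ (by omega)
  · exact sum_range_single_mem_edgeCone_of_cycle (p := fun i => p (2 * a + i))
      (fun i hi => hp _ (by omega)) hchord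
  · exact sum_range_single_mem_edgeCone_of_matching (p := fun i => p (2 * a + (k + 1) + i))
      fun i hi => hp _ (by omega)

end Paths

theorem one_mem_edgeCone_of_perm [Finite V] (σ : Equiv.Perm V) (hσ : ∀ v, G.Adj v (σ v)) :
    1 ∈ edgeCone G := by
  have := Fintype.ofFinite V
  have hsum := Submodule.smul_mem _ (2⁻¹ : ℝ≥0) <|
    sum_mem (t := univ) fun v _ => single_add_single_mem_edgeCone (hσ v)
  convert hsum using 1
  have hone : ∑ v : V, Pi.single v (1 : ℝ) = 1 := univ_sum_single 1
  rw [sum_add_distrib, Equiv.sum_comp σ fun v => (Pi.single v 1 : V → ℝ), hone, ← two_smul ℝ≥0,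
    inv_smul_smul₀ two_ne_zero]

theorem exists_sub_single_sub_mem_edgeCone_of_adj [Fintype V] {u v : V} (h : G.Adj u v) :
    ∃ t : V → ℝ≥0, ∑ w, t w = (Pi.single u 1 + Pi.single v 1 : V → ℝ) u ∧
      Pi.single u 1 + Pi.single v 1 - Pi.single u ((Pi.single u 1 + Pi.single v 1 : V → ℝ) u) -
        (fun w => (t w : ℝ)) ∈ edgeCone G := by
  refine ⟨Pi.single v 1, by simp [h.ne, Pi.single_apply], ?_⟩
  convert zero_mem (edgeCone G) using 1
  ext w
  simp [Pi.single_apply, h.ne, apply_ite NNReal.toReal]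

/-- Here `t w` is the weight of the edge `uw`, if any. -/
theorem exists_sub_single_sub_mem_edgeCone [Fintype V] (hd : d ∈ edgeCone G) (u : V) :
    ∃ t : V → ℝ≥0, ∑ w, t w = d u ∧ d - Pi.single u (d u) - (fun w => (t w : ℝ)) ∈ edgeCone G := by
  induction hd using edgeCone_induction with
  | edge x y hxy =>
    rcases eq_or_ne u x with rfl | hx
    · exact exists_sub_single_sub_mem_edgeCone_of_adj hxy
    rcases eq_or_ne u y with rfl | hy
    · rw [add_comm]
      exact exists_sub_single_sub_mem_edgeCone_of_adj hxy.symm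
    refine ⟨0, by simp [hx, hy], ?_⟩
    convert single_add_single_mem_edgeCone hxy using 1
    ext
    simp [hx, hy]
  | zero => exact ⟨0, by simp, by convert zero_mem (edgeCone G) using 1; ext; simp⟩
  | add x y _ _ hx hy =>
    obtain ⟨t, ht, hxt⟩ := hx
    obtain ⟨s, hs, hys⟩ := hy
    refine ⟨t + s, by simp [sum_add_distrib, ← ht, ← hs], ?_⟩
    convert add_mem hxt hys using 1
    ext w
    simp only [Pi.add_apply, Pi.sub_apply, Pi.single_add, NNReal.coe_add]
    ring
  | smul c x _ hx =>
    obtain ⟨t, ht, hxt⟩ := hx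
    refine ⟨c • t, by simp [← mul_sum, ← ht, NNReal.smul_def], ?_⟩
    convert Submodule.smul_mem _ c hxt using 1
    ext w
    simp only [Pi.smul_apply, Pi.sub_apply, Pi.single_apply, NNReal.smul_def, smul_eq_mul,
      NNReal.coe_mul]
    split_ifs <;> ring

/-- Each edge at `u` hands the weight it carried over to `g`, together with its other end. -/
theorem sub_single_add_mem_edgeCone [Finite V] (hd : d ∈ edgeCone G) {u : V} (hu : d u = 1)
    (hg : ∀ w, 0 < d w → Pi.single w 1 + g ∈ edgeCone G) :
    d - Pi.single u 1 + g ∈ edgeCone G := by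
  have := Fintype.ofFinite V
  obtain ⟨t, ht, hrest⟩ := exists_sub_single_sub_mem_edgeCone hd u
  rw [hu] at ht hrest
  have hpos (w : V) (hw : t w ≠ 0) : 0 < d w := by
    have hle := nonneg_of_mem_edgeCone hrest w
    have htw : (0 : ℝ) < t w := NNReal.coe_pos.2 (pos_iff_ne_zero.2 hw)
    have hsingle : (0 : V → ℝ) ≤ Pi.single u 1 := Pi.single_nonneg.2 zero_le_one
    have := hsingle w
    simp only [Pi.zero_apply, Pi.sub_apply] at hle this
    linarith
  have hsum : ∑ w, t w • (Pi.single w 1 + g) ∈ edgeCone G := sum_mem fun w _ => by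
    by_cases hw : t w = 0
    · rw [hw, zero_smul]
      exact zero_mem _
    · exact Submodule.smul_mem _ _ (hg w (hpos w hw))
  convert add_mem hrest hsum using 1
  have ht' : ∑ w, t w = 1 := by exact_mod_cast ht
  have hsingle : ∑ w, t w • (Pi.single w 1 : V → ℝ) = fun w => (t w : ℝ) := by
    ext w
    simp [Finset.sum_apply, Pi.single_apply, NNReal.smul_def]
  simp only [smul_add, sum_add_distrib, hsingle, ← sum_smul, ht', one_smul]
  abel

variable [Fintype V]

theorem exists_sum_incidenceFinset_eq [DecidableRel G.Adj] (hd : d ∈ edgeCone G) :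
    ∃ f : Sym2 V → ℝ, 0 ≤ f ∧ ∀ v, ∑ e ∈ G.incidenceFinset v, f e = d v := by
  induction hd using edgeCone_induction with
  | edge u v huv =>
    refine ⟨Pi.single s(u, v) 1, Pi.single_nonneg.2 zero_le_one, fun w => ?_⟩
    rw [sum_pi_single']
    simp only [mem_incidenceFinset, mk'_mem_incidenceSet_iff, huv, true_and, Pi.add_apply,
      Pi.single_apply]
    have := huv.ne
    split_ifs <;> simp_all
  | zero => exact ⟨0, le_rfl, by simp⟩
  | add x y _ _ hx hy =>
    obtain ⟨f, hf, hfx⟩ := hx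
    obtain ⟨f', hf', hfy⟩ := hy
    exact ⟨f + f', add_nonneg hf hf', fun v => by simp [sum_add_distrib, hfx, hfy]⟩
  | smul c x _ hx =>
    obtain ⟨f, hf, hfx⟩ := hx
    exact ⟨c • f, smul_nonneg c.2 hf, fun v => by simp [← smul_sum, hfx]⟩

theorem hasFractionalPerfectMatching_of_one_mem_edgeCone (h : 1 ∈ edgeCone G) :
    G.HasFractionalPerfectMatching := by
  classical
  obtain ⟨f, hf, hsum⟩ := exists_sum_incidenceFinset_eq h
  refine ⟨f, fun e he => ⟨hf e, ?_⟩, fun v => by convert hsum v; rfl⟩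
  induction e with | _ u v =>
  rw [← Pi.one_apply (M := fun _ : V => ℝ) u, ← hsum u]
  exact single_le_sum (fun e _ => hf e)
    ((mem_incidenceFinset _ _ _).2 ⟨he, Sym2.mem_mk_left u v⟩)

theorem not_hasFractionalPerfectMatching_of_isolated {V : Type*} [Fintype V] {G : SimpleGraph V}
    {v : V} (hv : ∀ w, ¬ G.Adj v w) : ¬ G.HasFractionalPerfectMatching := by
  classical
  rintro ⟨f, -, hf⟩
  have hempty : G.incidenceFinset v = ∅ := by
    refine eq_empty_of_forall_notMem fun e he => ?_
    obtain ⟨he, w, rfl⟩ := (mem_incidenceFinset _ _ _).1 he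
    exact hv w he
  have hsum := hf v
  convert_to ∑ e ∈ G.incidenceFinset v, f e = 1 at hsum
  rw [hempty, sum_empty] at hsum
  exact zero_ne_one hsum

section FaultNumbers

theorem not_adj_deleteEdges_incidenceFinset {V : Type*} [DecidableEq V] (G : SimpleGraph V) (v : V)
    [Fintype (G.neighborSet v)] (w : V) :
    ¬ (G.deleteEdges (G.incidenceFinset v : Set (Sym2 V))).Adj v w := fun h => by
  rw [coe_incidenceFinset] at h
  exact (deleteIncidenceSet_adj.1 h).2.1 rfl

variable {V : Type*} [Fintype V] (G : SimpleGraph V)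

theorem isFMPSet_incidenceFinset [DecidableEq V] (v : V) [Fintype (G.neighborSet v)] :
    G.IsFMPSet (G.incidenceFinset v) :=
  ⟨fun _ he => ((mem_incidenceFinset _ _ _).1 he).1,
    not_hasFractionalPerfectMatching_of_isolated (not_adj_deleteEdges_incidenceFinset G v)⟩

theorem isFSMPSet_incidenceFinset [DecidableEq V] (v : V) [Fintype (G.neighborSet v)] :
    G.IsFSMPSet ∅ (G.incidenceFinset v) :=
  ⟨(isFMPSet_incidenceFinset G v).1, not_hasFractionalPerfectMatching_of_isolated
    (v := ⟨v, by simp⟩) fun w => not_adj_deleteEdges_incidenceFinset G v w⟩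

theorem fmp_le_degree (v : V) [Fintype (G.neighborSet v)] : G.fmp ≤ G.degree v := by
  classical
  exact Nat.sInf_le ⟨_, isFMPSet_incidenceFinset G v, G.card_incidenceFinset_eq_degree v⟩

theorem fsmp_le_degree (v : V) [Fintype (G.neighborSet v)] : G.fsmp ≤ G.degree v := by
  classical
  exact Nat.sInf_le ⟨_, _, isFSMPSet_incidenceFinset G v, by
    rw [card_empty, zero_add, G.card_incidenceFinset_eq_degree v]⟩

variable {G} [Nonempty V] {k : ℕ}

theorem le_fmp [DecidableEq V]
    (h : ∀ F : Finset (Sym2 V), #F < k → 1 ∈ edgeCone (G.deleteEdges F)) :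
    k ≤ G.fmp := by
  classical
  refine le_csInf ⟨_, _, isFMPSet_incidenceFinset G (Classical.arbitrary V), rfl⟩ ?_
  rintro _ ⟨F, hF, rfl⟩
  by_contra! hlt
  exact hF.2 (hasFractionalPerfectMatching_of_one_mem_edgeCone (h F hlt))

theorem le_fsmp [DecidableEq V]
    (h : ∀ (FV : Finset V) (FE : Finset (Sym2 V)), #FV + #FE < k →
      (FVᶜ : Set V).indicator 1 ∈ edgeCone (G.deleteEdges FE)) :
    k ≤ G.fsmp := by
  classical
  refine le_csInf ⟨_, _, _, isFSMPSet_incidenceFinset G (Classical.arbitrary V), rfl⟩ ?_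
  rintro _ ⟨FV, FE, hF, rfl⟩
  by_contra! hlt
  refine hF.2 ?_
  convert hasFractionalPerfectMatching_of_one_mem_edgeCone
    (G := (G.deleteEdges FE).induce {v | v ∉ FV}) ?_
  convert comp_val_mem_edgeCone_induce (S := {v | v ∉ FV}) (h FV FE hlt) (by simp) with v
  simp

end FaultNumbers

end FractionalMatching

namespace Pancake

open FractionalMatching

variable {n : ℕ} {a b : Equiv.Perm (Fin n)}

/-- The reversal of the first `k` positions, taken to be the identity if `n < k`. -/
def prefixRev (n k : ℕ) : Equiv.Perm (Fin n) :=
  Function.Involutive.toPerm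
    (fun i => if h : (i : ℕ) < k ∧ k ≤ n then ⟨k - 1 - i, by omega⟩ else i) fun i => by
      by_cases h : (i : ℕ) < k ∧ k ≤ n
      · have h' : k - 1 - (i : ℕ) < k ∧ k ≤ n := by omega
        simp only [h, and_self, dif_pos, h']
        ext
        simp only
        omega
      · simp only [h, dif_neg, not_false_eq_true]

theorem prefixRev_val_of_lt {k : ℕ} (hk : k ≤ n) {i : Fin n} (hi : (i : ℕ) < k) :
    (prefixRev n k i : ℕ) = k - 1 - i := by
  simp [prefixRev, hi, hk]

theorem prefixRev_of_le {k : ℕ} {i : Fin n} (hi : k ≤ (i : ℕ)) : prefixRev n k i = i :=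
  dif_neg (by omega)

theorem prefixRev_mul_self (n k : ℕ) : prefixRev n k * prefixRev n k = 1 :=
  Equiv.ext (Function.Involutive.toPerm_involutive _)

theorem prefixRev_injOn : Set.InjOn (prefixRev n) (Icc 2 n) := by
  intro k hk l hl h
  rw [mem_coe, mem_Icc] at hk hl
  have hzero := congrArg Fin.val (Equiv.congr_fun h ⟨0, by omega⟩)
  rw [prefixRev_val_of_lt hk.2 (Nat.zero_lt_of_lt hk.1),
    prefixRev_val_of_lt hl.2 (Nat.zero_lt_of_lt hl.1)] at hzero
  simp only at hzero
  omega

theorem adj_iff : (pancakeGraph n).Adj a b ↔ ∃ k ∈ Icc 2 n, b = a * prefixRev n k := by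
  constructor
  · rintro ⟨k, hk, hkn, hrev, hfix⟩
    refine ⟨k, mem_Icc.2 ⟨hk, hkn⟩, Equiv.ext fun j => ?_⟩
    rw [Equiv.Perm.mul_apply]
    by_cases hj : (j : ℕ) < k
    · exact (hrev _ _ (by rw [prefixRev_val_of_lt hkn hj]; omega)).symm
    · rw [prefixRev_of_le (not_lt.1 hj), hfix j (not_lt.1 hj)]
  · rintro ⟨k, hk, rfl⟩
    obtain ⟨hk, hkn⟩ := mem_Icc.1 hk
    refine ⟨k, hk, hkn, fun i j hij => ?_, fun i hi => ?_⟩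
    · rw [Equiv.Perm.mul_apply]
      congr 1
      ext
      rw [prefixRev_val_of_lt hkn (by omega)]
      omega
    · rw [Equiv.Perm.mul_apply, prefixRev_of_le hi]

theorem adj_mul_left_iff (u : Equiv.Perm (Fin n)) :
    (pancakeGraph n).Adj (u * a) (u * b) ↔ (pancakeGraph n).Adj a b := by
  simp only [adj_iff, mul_assoc, mul_right_inj]

instance : DecidableRel (pancakeGraph n).Adj := fun _ _ => decidable_of_iff' _ adj_iff

theorem degree_le (a : Equiv.Perm (Fin n)) : (pancakeGraph n).degree a ≤ n - 1 := by
  have hsub : (pancakeGraph n).neighborFinset a ⊆ (Icc 2 n).image fun k => a * prefixRev n k := by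
    intro b hb
    obtain ⟨k, hk, rfl⟩ := adj_iff.1 ((mem_neighborFinset _ _ _).1 hb)
    exact mem_image_of_mem _ hk
  calc (pancakeGraph n).degree a
      ≤ #(Icc 2 n) := (card_le_card hsub).trans card_image_le
    _ = n - 1 := by simp

theorem exists_prefixRev_forall_notMem {FE : Finset (Sym2 (Equiv.Perm (Fin n)))}
    (hFE : #FE < n - 1) :
    ∃ k ∈ Icc 2 n, ∀ a, s(a, a * prefixRev n k) ∉ FE := by
  by_contra! h
  choose! a ha using h
  have hinj : Set.InjOn (fun k => s(a k, a k * prefixRev n k)) (Icc 2 n) := by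
    intro k hk l hl hkl
    apply prefixRev_injOn hk hl
    rcases Sym2.eq_iff.1 hkl with ⟨h₁, h₂⟩ | ⟨h₁, h₂⟩
    · exact mul_left_cancel (h₁ ▸ h₂)
    · rw [h₁, mul_assoc, mul_eq_left] at h₂
      exact mul_left_cancel (h₂.trans (prefixRev_mul_self n l).symm)
  have hcard := card_le_card_of_injOn _ ha hinj
  rw [Nat.card_Icc] at hcard
  omega

theorem one_mem_edgeCone_deleteEdges {FE : Finset (Sym2 (Equiv.Perm (Fin n)))}
    (hFE : #FE < n - 1) : 1 ∈ edgeCone ((pancakeGraph n).deleteEdges FE) := by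
  obtain ⟨k, hk, hkFE⟩ := exists_prefixRev_forall_notMem hFE
  exact one_mem_edgeCone_of_perm (Equiv.mulRight (prefixRev n k)) fun a =>
    deleteEdges_adj.2 ⟨adj_iff.2 ⟨k, hk, rfl⟩, hkFE a⟩

theorem fmp_pancakeGraph (n : ℕ) : (pancakeGraph n).fmp = n - 1 :=
  le_antisymm ((fmp_le_degree _ 1).trans (degree_le 1))
    (le_fmp fun _ => one_mem_edgeCone_deleteEdges)

/-- `PG_n` has a fractional perfect matching whenever fewer than `n - 1` faults, vertices or edges,
are deleted from it. -/
def FaultTolerant (n : ℕ) : Prop :=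
  ∀ (FV : Finset (Equiv.Perm (Fin n))) (FE : Finset (Sym2 (Equiv.Perm (Fin n)))),
    #FV + #FE < n - 1 →
      (FVᶜ : Set (Equiv.Perm (Fin n))).indicator 1 ∈ edgeCone ((pancakeGraph n).deleteEdges FE)

section DimensionFour

/-- A cycle in `PG_4` through all the words but the identity, found by a computer search and given
by the lengths of its successive prefix reversals. -/
def detour (i : ZMod 23) : Equiv.Perm (Fin 4) :=
  (([4, 2, 3, 4, 3, 4, 3, 4, 3, 2, 4, 3, 2, 3, 4, 3, 2, 4, 2, 3, 4, 3, 2].take (i.val + 1)).map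
    (prefixRev 4)).prod

theorem detour_injective : Function.Injective detour := by
  decide +kernel

theorem exists_detour_eq_iff : ∀ x, (∃ i, detour i = x) ↔ x ≠ 1 := by
  decide +kernel

theorem adj_detour : ∀ i, (pancakeGraph 4).Adj (detour i) (detour (i + 1)) := by
  decide +kernel

theorem detour_edge_injective : Function.Injective fun i => s(detour i, detour (i + 1)) := by
  decide +kernel

/-- A deleted edge of the cycle is bypassed by a chord that cuts off an even number of vertices on
each side of it. -/
theorem exists_chord_detour : ∀ i, ∃ a ∈ range 11, ∃ b ∈ range (11 - a),
    (pancakeGraph 4).Adj (detour (i - (2 * b : ℕ))) (detour (i + 1 + (2 * a : ℕ))) ∧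
      s(detour (i - (2 * b : ℕ)), detour (i + 1 + (2 * a : ℕ))) ≠
        s(detour i, detour (i + 1)) := by
  decide +kernel

theorem sum_single_detour (u : Equiv.Perm (Fin 4)) (j : ZMod 23) :
    ∑ i ∈ range (22 + 1), Pi.single (u * detour (j + i)) 1 =
      ({u}ᶜ : Set (Equiv.Perm (Fin 4))).indicator (1 : Equiv.Perm (Fin 4) → ℝ) := by
  have hrange : ∑ i ∈ range (22 + 1), Pi.single (u * detour (j + i)) 1 =
      ∑ i, (Pi.single (u * detour i) 1 : Equiv.Perm (Fin 4) → ℝ) := by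
    rw [← Equiv.sum_comp (Equiv.addLeft j)]
    exact sum_nbij' Nat.cast ZMod.val (by simp) (fun i _ => mem_range.2 i.val_lt)
      (fun i hi => ZMod.val_natCast_of_lt (mem_range.1 hi)) (fun i _ => i.natCast_zmod_val)
      fun _ _ => rfl
  have himage : univ.image (fun i => u * detour i) = {u}ᶜ := by
    ext w
    have hw : ∀ i, u * detour i = w ↔ detour i = u⁻¹ * w := fun i => eq_inv_mul_iff_mul_eq.symm
    simp only [mem_image, mem_univ, true_and, hw, exists_detour_eq_iff, mem_compl, mem_singleton]
    rw [ne_eq, inv_mul_eq_one, eq_comm]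
  rw [hrange, ← sum_image (f := fun w => (Pi.single w 1 : Equiv.Perm (Fin 4) → ℝ))
    fun i _ k _ h => detour_injective (mul_left_cancel h), himage]
  ext w
  simp [Finset.sum_apply, Pi.single_apply, Set.indicator_apply]

theorem indicator_compl_pair_mem_edgeCone {u v : Equiv.Perm (Fin 4)} (huv : u ≠ v) :
    ({u, v}ᶜ : Set _).indicator 1 ∈ edgeCone (pancakeGraph 4) := by
  obtain ⟨j, hj⟩ := (exists_detour_eq_iff (u⁻¹ * v)).2 (by rwa [ne_eq, inv_mul_eq_one])
  have hmatching := sum_range_single_mem_edgeCone_of_matching (G := pancakeGraph 4) (k := 11)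
    (p := fun i => u * detour (j + 1 + i)) fun i _ => by
      simpa [add_assoc] using (adj_mul_left_iff u).2 (adj_detour (j + 1 + (2 * i : ℕ)))
  have hlast : j + 1 + (22 : ℕ) = j := by
    rw [add_assoc, show (1 : ZMod 23) + (22 : ℕ) = 0 from rfl, add_zero]
  have hsum := (sum_range_succ _ 22).symm.trans (sum_single_detour u (j + 1))
  rw [hlast, hj, mul_inv_cancel_left] at hsum
  convert hmatching using 1
  rw [eq_sub_of_add_eq hsum]
  ext w
  by_cases hwu : w = u <;> by_cases hwv : w = v <;> simp_all

theorem indicator_compl_singleton_mem_edgeCone (u : Equiv.Perm (Fin 4))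
    {FE : Finset (Sym2 (Equiv.Perm (Fin 4)))} (hFE : #FE ≤ 1) :
    ({u}ᶜ : Set _).indicator 1 ∈ edgeCone ((pancakeGraph 4).deleteEdges FE) := by
  obtain ⟨e, hadj⟩ : ∃ e, ∀ a b, (pancakeGraph 4).Adj a b → s(a, b) ≠ e →
      ((pancakeGraph 4).deleteEdges FE).Adj (u * a) (u * b) := by
    obtain ⟨e, he⟩ := card_le_one_iff_subset_singleton.1 hFE
    refine ⟨e.map (u⁻¹ * ·), fun a b hab hne => deleteEdges_adj.2 ⟨(adj_mul_left_iff u).2 hab,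
      fun h => hne ?_⟩⟩
    rw [← mem_singleton.1 (he h), Sym2.map_mk, inv_mul_cancel_left, inv_mul_cancel_left]
  by_cases hej : ∃ j, s(detour j, detour (j + 1)) = e
  · obtain ⟨j, rfl⟩ := hej
    obtain ⟨a, ha, b, hb, hchord, hne⟩ := exists_chord_detour j
    rw [mem_range] at ha hb
    obtain ⟨k, hk⟩ : ∃ k, 2 * a + k + 2 * b = 22 := ⟨22 - 2 * b - 2 * a, by omega⟩
    have hchord_end : j - (2 * b : ℕ) = j + 1 + (2 * a + k : ℕ) := by
      rw [sub_eq_iff_eq_add, add_assoc, add_assoc, ← Nat.cast_add, hk,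
        show (1 : ZMod 23) + (22 : ℕ) = 0 from rfl, add_zero]
    rw [← sum_single_detour u (j + 1), ← hk]
    refine sum_range_single_mem_edgeCone_of_chord (p := fun i => u * detour (j + 1 + i))
      (fun i hi => ?_) (hadj _ _ (hchord_end ▸ hchord) (hchord_end ▸ hne))
    have hi0 : ((i + 1 : ℕ) : ZMod 23) ≠ 0 := fun h =>
      absurd (Nat.le_of_dvd i.succ_pos ((ZMod.natCast_eq_zero_iff _ _).1 h)) (by omega)
    rw [Nat.cast_add, Nat.cast_one, ← add_assoc]
    exact hadj _ _ (adj_detour _) (detour_edge_injective.ne fun h => hi0 (by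
      rwa [add_assoc, add_eq_left, add_comm, ← Nat.cast_succ] at h))
  · push Not at hej
    have hstep (i : ZMod 23) := hadj _ _ (adj_detour i) (hej i)
    rw [← sum_single_detour u 0]
    refine sum_range_single_mem_edgeCone_of_cycle (k := 22) (p := fun i => u * detour (0 + i))
      (fun i _ => ?_) (hstep _)
    rw [Nat.cast_add, Nat.cast_one, ← add_assoc]
    exact hstep _

theorem faultTolerant_four : FaultTolerant 4 := by
  intro FV FE hF
  rcases FV.eq_empty_or_nonempty with rfl | ⟨u, huFV⟩
  · rw [card_empty, zero_add] at hF
    simpa using one_mem_edgeCone_deleteEdges hF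
  obtain ⟨FV, hu, rfl⟩ : ∃ FV', u ∉ FV' ∧ insert u FV' = FV :=
    ⟨FV.erase u, notMem_erase u FV, insert_erase huFV⟩
  rw [card_insert_of_notMem hu] at hF
  rcases FV.eq_empty_or_nonempty with rfl | ⟨v, hv⟩
  · rw [card_empty] at hF
    simpa using indicator_compl_singleton_mem_edgeCone u (FE := FE) (by omega)
  · have hcard : #FV = 1 ∧ #FE = 0 := by
      have := card_pos.2 ⟨v, hv⟩
      omega
    obtain ⟨w, rfl⟩ := card_eq_one.1 hcard.1
    rw [card_eq_zero.1 hcard.2]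
    simpa using indicator_compl_pair_mem_edgeCone (notMem_singleton.1 hu)

end DimensionFour

section Layers

variable {FV : Finset (Equiv.Perm (Fin (n + 1)))} {FE : Finset (Sym2 (Equiv.Perm (Fin (n + 1))))}
  {j : Fin (n + 1)}

/-- The word `x` on `n` symbols followed by the last of `n + 1` symbols. -/
noncomputable def extendLast (n : ℕ) : Equiv.Perm (Fin n) →* Equiv.Perm (Fin (n + 1)) :=
  Equiv.Perm.viaEmbeddingHom Fin.castSuccEmb

theorem extendLast_injective : Function.Injective (extendLast n) :=
  Equiv.Perm.viaEmbeddingHom_injective _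

theorem extendLast_castSucc (x : Equiv.Perm (Fin n)) (i : Fin n) :
    extendLast n x i.castSucc = (x i).castSucc :=
  Equiv.Perm.viaEmbedding_apply x Fin.castSuccEmb i

theorem extendLast_last (x : Equiv.Perm (Fin n)) : extendLast n x (Fin.last n) = Fin.last n :=
  Equiv.Perm.viaEmbedding_apply_of_notMem x Fin.castSuccEmb _ (by simp)

theorem extendLast_prefixRev {k : ℕ} (hk : k ≤ n) :
    extendLast n (prefixRev n k) = prefixRev (n + 1) k := by
  ext i
  induction i using Fin.lastCases with
  | last => rw [extendLast_last, prefixRev_of_le (by simpa using hk)]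
  | cast i =>
    rw [extendLast_castSucc, Fin.val_castSucc]
    by_cases hi : (i : ℕ) < k
    · rw [prefixRev_val_of_lt hk hi, prefixRev_val_of_lt (by omega) (by simpa using hi),
        Fin.val_castSucc]
    · rw [prefixRev_of_le (not_lt.1 hi), prefixRev_of_le (by simpa using hi), Fin.val_castSucc]

theorem adj_mul_extendLast (a : Equiv.Perm (Fin (n + 1))) {x y : Equiv.Perm (Fin n)}
    (h : (pancakeGraph n).Adj x y) :
    (pancakeGraph (n + 1)).Adj (a * extendLast n x) (a * extendLast n y) := by
  obtain ⟨k, hk, rfl⟩ := adj_iff.1 h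
  obtain ⟨hk2, hkn⟩ := mem_Icc.1 hk
  refine adj_iff.2 ⟨k, mem_Icc.2 ⟨hk2, by omega⟩, ?_⟩
  rw [map_mul, extendLast_prefixRev hkn, mul_assoc]

theorem exists_extendLast_eq {v : Equiv.Perm (Fin (n + 1))} (hv : v (Fin.last n) = Fin.last n) :
    ∃ x, extendLast n x = v := by
  have hne (i : Fin n) : v i.castSucc ≠ Fin.last n := fun h =>
    Fin.castSucc_ne_last i (v.injective (h.trans hv.symm))
  have hinj : Function.Injective fun i : Fin n => (v i.castSucc).castPred (hne i) := fun i k h =>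
    Fin.castSucc_injective n (v.injective (Fin.castPred_inj.1 h))
  refine ⟨Equiv.ofBijective _ (Finite.injective_iff_bijective.1 hinj), Equiv.ext fun i => ?_⟩
  induction i using Fin.lastCases with
  | last => rw [extendLast_last, hv]
  | cast i => rw [extendLast_castSucc, Equiv.ofBijective_apply, Fin.castSucc_castPred]

theorem exists_mul_extendLast_eq_iff {a v : Equiv.Perm (Fin (n + 1))} :
    (∃ x, a * extendLast n x = v) ↔ v (Fin.last n) = a (Fin.last n) := by
  constructor
  · rintro ⟨x, rfl⟩
    rw [Equiv.Perm.mul_apply, extendLast_last]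
  · intro h
    obtain ⟨x, hx⟩ := exists_extendLast_eq (v := a⁻¹ * v) (by
      rw [Equiv.Perm.mul_apply, h, ← Equiv.Perm.mul_apply, inv_mul_cancel, Equiv.Perm.one_apply])
    exact ⟨x, by rw [hx, mul_inv_cancel_left]⟩

/-- The number of faulty vertices and edges lying within the copy of `PG_n` that is formed by the
words ending in `j`. -/
def layerFaults (FV : Finset (Equiv.Perm (Fin (n + 1))))
    (FE : Finset (Sym2 (Equiv.Perm (Fin (n + 1))))) (j : Fin (n + 1)) : ℕ :=
  #{v ∈ FV | v (Fin.last n) = j} + #{e ∈ FE | e.map (· (Fin.last n)) = s(j, j)}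

theorem FaultTolerant.indicator_layer_mem_edgeCone (ih : FaultTolerant n)
    (hj : layerFaults FV FE j < n - 1) :
    {v | v (Fin.last n) = j ∧ v ∉ FV}.indicator 1 ∈
      edgeCone ((pancakeGraph (n + 1)).deleteEdges FE) := by
  obtain ⟨a, rfl⟩ : ∃ a : Equiv.Perm (Fin (n + 1)), a (Fin.last n) = j :=
    ⟨Equiv.swap (Fin.last n) j, Equiv.swap_apply_left _ _⟩
  set φ := fun x => a * extendLast n x
  have hφinj : φ.Injective := (mul_right_injective a).comp extendLast_injective
  have hφlast (x) : φ x (Fin.last n) = a (Fin.last n) := exists_mul_extendLast_eq_iff.1 ⟨x, rfl⟩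
  have hFV : #{x | φ x ∈ FV} ≤ #{v ∈ FV | v (Fin.last n) = a (Fin.last n)} :=
    card_le_card_of_injOn φ (fun x hx => by simpa [hφlast] using hx) hφinj.injOn
  have hFE : #{e | Sym2.map φ e ∈ FE} ≤
      #{e ∈ FE | e.map (· (Fin.last n)) = s(a (Fin.last n), a (Fin.last n))} :=
    card_le_card_of_injOn (Sym2.map φ)
      (fun e he => by induction e; simpa [hφlast] using he) (Sym2.map.injective hφinj).injOn
  convert indicator_image_mem_edgeCone (H := (pancakeGraph (n + 1)).deleteEdges FE) hφinj ?_
    (ih {x | φ x ∈ FV} {e | Sym2.map φ e ∈ FE} ((add_le_add hFV hFE).trans_lt hj)) using 2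
  · ext v
    constructor
    · rintro ⟨hv, hvFV⟩
      obtain ⟨x, rfl⟩ := exists_mul_extendLast_eq_iff.2 hv
      exact ⟨x, by simpa using hvFV, rfl⟩
    · rintro ⟨x, hx, rfl⟩
      exact ⟨hφlast x, by simpa using hx⟩
  · intro x y hxy
    rw [deleteEdges_adj] at hxy ⊢
    exact ⟨adj_mul_extendLast a hxy.1, by simpa using hxy.2⟩

theorem FaultTolerant.indicator_layers_mem_edgeCone (ih : FaultTolerant n)
    {T : Finset (Fin (n + 1))} (hT : ∀ j ∈ T, layerFaults FV FE j < n - 1) :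
    {v | v (Fin.last n) ∈ T ∧ v ∉ FV}.indicator 1 ∈
      edgeCone ((pancakeGraph (n + 1)).deleteEdges FE) := by
  convert sum_mem fun j hj => ih.indicator_layer_mem_edgeCone (hT j hj) using 1
  ext v
  by_cases hv : v ∈ FV <;> simp [Finset.sum_apply, Set.indicator_apply, hv]

theorem exists_adj_deleteEdges_last_ne (hn : n ≠ 0)
    (hFE : ∀ e ∈ FE, e.map (· (Fin.last n)) = s(j, j)) (w : Equiv.Perm (Fin (n + 1))) :
    ∃ r, ((pancakeGraph (n + 1)).deleteEdges FE).Adj w r ∧ r (Fin.last n) ≠ w (Fin.last n) := by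
  set r := w * prefixRev (n + 1) (n + 1)
  have hr : r (Fin.last n) ≠ w (Fin.last n) := by
    rw [Equiv.Perm.mul_apply, w.injective.ne_iff, Fin.ne_iff_vne,
      prefixRev_val_of_lt le_rfl (Fin.is_lt _)]
    simp [hn.symm]
  refine ⟨r, deleteEdges_adj.2 ⟨adj_iff.2 ⟨n + 1, mem_Icc.2 (by omega), rfl⟩, fun h => hr ?_⟩, hr⟩
  obtain ⟨hw, hr⟩ : w (Fin.last n) = j ∧ r (Fin.last n) = j := by simpa using hFE _ h
  rw [hw, hr]

theorem FaultTolerant.single_add_indicator_mem_edgeCone (hn : 3 ≤ n) (ih : FaultTolerant n)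
    (hFE : ∀ e ∈ FE, e.map (· (Fin.last n)) = s(j, j)) {w : Equiv.Perm (Fin (n + 1))}
    (hw : w (Fin.last n) = j) :
    Pi.single w 1 + {v | v (Fin.last n) ≠ j}.indicator 1 ∈
      edgeCone ((pancakeGraph (n + 1)).deleteEdges FE) := by
  obtain ⟨r, hwr, hrj⟩ := exists_adj_deleteEdges_last_ne (by omega) hFE w
  rw [hw] at hrj
  have hothers := ih.indicator_layers_mem_edgeCone (FV := {r}) (FE := FE) (T := {j}ᶜ) <| by
    intro i hi
    have hE : {e ∈ FE | e.map (· (Fin.last n)) = s(i, i)} = ∅ :=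
      filter_false_of_mem fun e he => by simpa [hFE e he, eq_comm] using hi
    have hV := card_filter_le {r} fun v => v (Fin.last n) = i
    rw [card_singleton] at hV
    rw [layerFaults, hE, card_empty]
    omega
  convert add_mem (single_add_single_mem_edgeCone hwr) hothers using 1
  rw [add_assoc]
  congr 1
  ext v
  by_cases hv : v = r <;> simp [Set.indicator_apply, hv, hrj]

/-- One faulty vertex `u` of the layer is restored; the edges at `u` in the resulting matching are
then rerouted to the other layers. -/
theorem FaultTolerant.indicator_compl_mem_edgeCone_of_layer (hn : 3 ≤ n) (ih : FaultTolerant n)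
    (hF : #FV + #FE < n) (hFV : ∀ v ∈ FV, v (Fin.last n) = j)
    (hFE : ∀ e ∈ FE, e.map (· (Fin.last n)) = s(j, j)) {u : Equiv.Perm (Fin (n + 1))}
    (hu : u ∈ FV) :
    (FVᶜ : Set (Equiv.Perm (Fin (n + 1)))).indicator 1 ∈
      edgeCone ((pancakeGraph (n + 1)).deleteEdges FE) := by
  have huj := hFV u hu
  have hlayer := ih.indicator_layer_mem_edgeCone (FV := FV.erase u) (FE := FE) (j := j) <| by
    have hV := card_filter_le (FV.erase u) fun v => v (Fin.last n) = j
    have hE := card_filter_le FE fun e => e.map (· (Fin.last n)) = s(j, j)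
    have := card_erase_add_one hu
    rw [layerFaults]
    omega
  convert sub_single_add_mem_edgeCone hlayer (u := u) (by simp [huj]) fun w hw =>
    ih.single_add_indicator_mem_edgeCone hn hFE (Set.mem_of_indicator_ne_zero hw.ne').1 using 1
  ext v
  by_cases hvu : v = u
  · simp [hvu, hu, huj]
  · by_cases hvj : v (Fin.last n) = j
    · simp [Set.indicator_apply, hvu, hvj]
    · simp [hvu, hvj, mt (hFV v) hvj]

theorem FaultTolerant.succ (hn : 3 ≤ n) (ih : FaultTolerant n) : FaultTolerant (n + 1) := by
  intro FV FE hF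
  rw [Nat.add_sub_cancel] at hF
  rcases FV.eq_empty_or_nonempty with rfl | ⟨u, hu⟩
  · rw [card_empty, zero_add] at hF
    simpa using one_mem_edgeCone_deleteEdges (n := n + 1) hF
  by_cases hspread : ∀ j, layerFaults FV FE j < n - 1
  · simpa [Set.compl_def] using ih.indicator_layers_mem_edgeCone (T := univ) fun j _ => hspread j
  push Not at hspread
  obtain ⟨j, hj⟩ := hspread
  have hV := card_filter_le FV fun v => v (Fin.last n) = j
  have hE := card_filter_le FE fun e => e.map (· (Fin.last n)) = s(j, j)
  rw [layerFaults] at hj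
  have hFV := card_filter_eq_iff.1 (show #{v ∈ FV | v (Fin.last n) = j} = #FV by omega)
  have hFE := card_filter_eq_iff.1
    (show #{e ∈ FE | e.map (· (Fin.last n)) = s(j, j)} = #FE by omega)
  exact ih.indicator_compl_mem_edgeCone_of_layer hn hF hFV hFE hu

end Layers

theorem faultTolerant (hn : 4 ≤ n) : FaultTolerant n := by
  induction n, hn using Nat.le_induction with
  | base => exact faultTolerant_four
  | succ n hn ih => exact ih.succ (by omega)

theorem fsmp_pancakeGraph (hn : 4 ≤ n) : (pancakeGraph n).fsmp = n - 1 :=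
  le_antisymm ((fsmp_le_degree _ 1).trans (degree_le 1)) (le_fsmp (faultTolerant hn))

end Pancake

theorem theorem4p36 (n : ℕ) (hn : 4 ≤ n) :
    (pancakeGraph n).fsmp = (pancakeGraph n).fmp ∧ (pancakeGraph n).fmp = n - 1 :=
  ⟨(Pancake.fsmp_pancakeGraph hn).trans (Pancake.fmp_pancakeGraph n).symm,
    Pancake.fmp_pancakeGraph n⟩
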